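/- All Hilbert spaces are complex and all operators are bounded and linear. Let $\Lambda$ be an index set and let $q=\{q_{\alpha\beta}:\alpha\ne\beta\in\Lambda\}$ be complex numbers with $|q_{\alpha\beta}|=1$ and $q_{\alpha\beta}=q_{\beta\alpha}^{-1}$. A family $\{T_\alpha:\alpha\in\Lambda\}$ of operators on a Hilbert space is called $q$-commuting if $T_\alpha T_\beta=q_{\alpha\beta}T_\beta T_\alpha$ for all $\alpha\neq\beta$, and doubly $q$-commuting if, in addition, $T_\alpha T_\beta^*=\overline{q}_{\alpha\beta}T_\beta^*T_\alpha$ for all $\alpha\ne\beta$. For $m\in\mathbb Z$ put $m^+=\max\{m,0\}$ and $m^-=\max\{-m,0\}$. A $q$-commuting family $\{T_\alpha:\alpha\in\Lambda\}$ of contractions on a Hilbert space $\mathcal H$ admits a regular $q$-unitary dilation if there are a Hilbert space $\mathcal K\supseteq\mathcal H$ and a $q$-commuting family $\{U_\alpha:\alpha\in\Lambda\}$ of unitaries on $\mathcal K$ (with the same scalars $q$) such that $$\prod_{1\le i<j\le k}q_{\alpha_i\alpha_j}^{-m_i^+m_j^-}\,\Big[(T_{\alpha_1}^{m_1^-})^*\cdots(T_{\alpha_k}^{m_k^-})^*\Big]\Big[T_{\alpha_1}^{m_1^+}\cdots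 T_{\alpha_k}^{m_k^+}\Big]=P_{\mathcal H}\,U_{\alpha_1}^{m_1}\cdots U_{\alpha_k}^{m_k}\big|_{\mathcal H}$$ for all finite tuples of pairwise distinct indices $\alpha_1,\dots,\alpha_k\in\Lambda$ and all $m_1,\dots,m_k\in\mathbb Z$, where $P_{\mathcal H}$ is the orthogonal projection of $\mathcal K$ onto $\mathcal H$. Theorem. Let $\{T_\alpha:\alpha\in\Lambda\}$ be a $q$-commuting family of contractions on a Hilbert space $\mathcal H$. Then it admits a regular $q$-unitary dilation in each of the following cases: (i) every $T_\alpha$ is an isometry; (ii) the family is doubly $q$-commuting; (iii) $\Lambda$ is countable and $\sum_{\alpha\in\Lambda}\|T_\alpha\|^2\le1$. -/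

import Mathlib

universe u v

namespace QComm

/-- `q` is a family of unimodular scalars `q α β`, `α ≠ β`, with `q α β = (q β α)⁻¹`.
The diagonal values `q α α` carry no meaning: nothing is assumed about them and nothing below
depends on them. -/
def IsUnimodularFamily {Λ : Type v} (q : Λ → Λ → ℂ) : Prop :=
  ∀ α β : Λ, α ≠ β → ‖q α β‖ = 1 ∧ q α β = (q β α)⁻¹

/-- `T α T β = q α β T β T α` for all `α ≠ β`. -/
def IsQCommuting {Λ : Type v} {H : Type u} [NormedAddCommGroup H] [InnerProductSpace ℂ H]
    (q : Λ → Λ → ℂ) (T : Λ → H →L[ℂ] H) : Prop :=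
  ∀ α β : Λ, α ≠ β → T α * T β = q α β • (T β * T α)

/-- `T` is `q`-commuting and `T α (T β)* = conj (q α β) (T β)* T α` for all `α ≠ β`. -/
def IsDoublyQCommuting {Λ : Type v} {H : Type u} [NormedAddCommGroup H] [InnerProductSpace ℂ H]
    [CompleteSpace H] (q : Λ → Λ → ℂ) (T : Λ → H →L[ℂ] H) : Prop :=
  IsQCommuting q T ∧
    ∀ α β : Λ, α ≠ β → T α * star (T β) = starRingEnd ℂ (q α β) • (star (T β) * T α)

/-- The operator
`∏_{i<j} q_{α_i α_j}^{-m_i⁺ m_j⁻} [(T_{α_1}^{m_1⁻})* ⋯ (T_{α_k}^{m_k⁻})*] [T_{α_1}^{m_1⁺} ⋯ T_{α_k}^{m_k⁺}]`,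
where `m⁺ = max m 0` and `m⁻ = max (-m) 0`; the operator products are taken from left to right. -/
noncomputable def regularProduct {Λ : Type v} {H : Type u} [NormedAddCommGroup H]
    [InnerProductSpace ℂ H] [CompleteSpace H] (q : Λ → Λ → ℂ) (T : Λ → H →L[ℂ] H)
    {k : ℕ} (α : Fin k → Λ) (m : Fin k → ℤ) : H →L[ℂ] H :=
  (∏ i : Fin k, ∏ j ∈ Finset.Ioi i, q (α i) (α j) ^ (-(max (m i) 0 * max (-m j) 0))) •
    ((List.ofFn fun i => star (T (α i) ^ (-m i).toNat)).prod *
      (List.ofFn fun i => T (α i) ^ (m i).toNat).prod)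

/-- `T` has a regular `q`-unitary dilation: there are a Hilbert space `K` containing `H`
(through a linear isometry `V`, whose adjoint is the orthogonal projection of `K` onto the copy
of `H`, read as a map to `H`) and a `q`-commuting family `U` of unitaries on `K`, with the same
scalars `q`, such that the regular product of `T` is the compression to `H` of
`U_{α_1}^{m_1} ⋯ U_{α_k}^{m_k}`, for all finite tuples of distinct indices and all integer
exponents. -/
def HasRegularQUnitaryDilation {Λ : Type v} {H : Type u} [NormedAddCommGroup H]
    [InnerProductSpace ℂ H] [CompleteSpace H] (q : Λ → Λ → ℂ) (T : Λ → H →L[ℂ] H) : Prop :=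
  ∃ (K : Type (max u v)) (_ : NormedAddCommGroup K) (_ : InnerProductSpace ℂ K)
    (_ : CompleteSpace K) (V : H →ₗᵢ[ℂ] K) (U : Λ → unitary (K →L[ℂ] K)),
    IsQCommuting q (fun α => (U α : K →L[ℂ] K)) ∧
    ∀ (k : ℕ) (α : Fin k → Λ) (m : Fin k → ℤ), Function.Injective α →
      regularProduct q T α m =
        (ContinuousLinearMap.adjoint V.toContinuousLinearMap) ∘L
          ((List.ofFn fun i => U (α i) ^ m i).prod : unitary (K →L[ℂ] K)).1 ∘L
            V.toContinuousLinearMap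

end QComm

namespace QComm

open UniformSpace

/-! Order `Λ` linearly and write `q i j = phase (θ i j - θ j i)` with `θ i j = 0` for `i ≤ j`.
Ordered monomials `T^a`, `a ≥ 0` in `Λ →₀ ℤ`, then satisfy `T^a T^b = phase (θ(a,b)) T^(a+b)` for
the bilinear form `θ`, and a `q`-commuting family of unitaries comes from a projective
representation `W` of `Λ →₀ ℤ` with this cocycle. If `W` is a regular dilation, the compression of
`W(m)* W(n)` to `H` is forced: up to an explicit phase it is `(T^(m-m∧n))* T^(n-m∧n)`
(`regularKernel`). Conversely, when this kernel is positive semidefinite, a GNS construction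
(`exists_projective_dilation`) produces `W`.

Positivity is Brehmer's argument. The identity telescopes into conjugates of the operators `defect T
S` (`sum_defect`), and the phases split so that the kernel becomes `∑_l A(l,m)* Δ_l A(l,n)` with
each `Δ_l` a defect (`regularKernel_eq_sum`). It therefore suffices that all defects are
nonnegative, which is checked separately in the three cases.

The dilation formula for arbitrary, unordered tuples needs no phase computation: reordering costs
the same phase for `T` and for `W`, so only the kernel at disjointly supported exponents matters. -/

/-- The unimodular number `exp (i x)`. -/
noncomputable def phase (x : ℝ) : ℂ := Complex.exp (x * Complex.I)

@[simp] lemma phase_zero : phase 0 = 1 := by simp [phase]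

lemma phase_add (x y : ℝ) : phase (x + y) = phase x * phase y := by
  simp [phase, add_mul, Complex.exp_add]

lemma phase_neg (x : ℝ) : phase (-x) = (phase x)⁻¹ := by
  simp [phase, Complex.exp_neg]

@[simp] lemma conj_phase (x : ℝ) : starRingEnd ℂ (phase x) = phase (-x) := by
  simp [phase, ← Complex.exp_conj]

@[simp] lemma star_phase (x : ℝ) : star (phase x) = phase (-x) := conj_phase x

/-! ### Projective unitary representations on completions -/

section Completion

variable {G : Type*} [AddCommGroup G] {E : Type*} [SeminormedAddCommGroup E]
  [InnerProductSpace ℂ E]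

/-- A projective isometric action on a semi-inner product space extends to a projective unitary
representation on the completion. -/
lemma exists_unitary_completion (B : G →ₗ[ℤ] G →ₗ[ℤ] ℝ) (w : G → E →ₗᵢ[ℂ] E)
    (w_zero : ∀ x, w 0 x = x)
    (w_mul : ∀ s t x, w s (w t x) = phase (B s t) • w (s + t) x) :
    ∃ W : G → unitary (Completion E →L[ℂ] Completion E),
      (∀ s (x : E), (W s : Completion E →L[ℂ] Completion E) x = (w s x : Completion E)) ∧
      ∀ s t, (W s : Completion E →L[ℂ] Completion E) * W t = phase (B s t) • (W (s + t)).1 := by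
  have ext_coe : ∀ A A' : Completion E →L[ℂ] Completion E,
      (∀ x : E, A (x : Completion E) = A' (x : Completion E)) → A = A' := fun A A' h =>
    ContinuousLinearMap.ext fun z => congrFun (Completion.ext A.continuous A'.continuous h) z
  have exists_ext : ∀ s, ∃ A : Completion E →L[ℂ] Completion E,
      ∀ x : E, A (x : Completion E) = (w s x : Completion E) := fun s =>
    ⟨(w s).toContinuousLinearMap.completion, fun x =>
      ContinuousLinearMap.completion_apply_coe _ _⟩
  choose F F_coe using exists_ext
  have F_mul : ∀ s t, F s * F t = phase (B s t) • F (s + t) := by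
    intro s t
    refine ext_coe _ _ fun x => ?_
    change F s (F t x) = phase (B s t) • F (s + t) x
    rw [F_coe, F_coe, F_coe, w_mul, Completion.coe_smul]
  have F_zero : F 0 = 1 := ext_coe _ _ fun x => by
    rw [F_coe, w_zero, one_apply_eq_self]
  have F_star : ∀ s, star (F s) * F s = 1 := by
    intro s
    have : ∀ z, ‖F s z‖ = ‖z‖ := congrFun <| Completion.ext (F s).continuous.norm continuous_norm
      fun x => by rw [F_coe, Completion.norm_coe, Completion.norm_coe, (w s).norm_map]
    exact (ContinuousLinearMap.norm_map_iff_adjoint_comp_self (F s)).1 this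
  -- An isometry with a right inverse is unitary; `phase (B s s)` cancels the cocycle value at `(s,
  -- -s)`.
  have F_inv : ∀ s, F s * (phase (B s s) • F (-s)) = 1 := by
    intro s
    rw [mul_smul_comm, F_mul, smul_smul, ← phase_add]
    simp [F_zero]
  refine ⟨fun s => ⟨F s, Unitary.mem_iff.2 ⟨F_star s, ?_⟩⟩, F_coe, F_mul⟩
  rw [left_inv_eq_right_inv (F_star s) (F_inv s), F_inv s]

end Completion

/-! ### The GNS construction for twisted-invariant operator kernels -/

section GNS

variable {G : Type v} {H : Type u} [NormedAddCommGroup H]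
  [InnerProductSpace ℂ H]

/-- The sesquilinear form on finitely supported functions given by an operator-valued kernel. -/
noncomputable def kernelForm (κ : G → G → H →L[ℂ] H) (f g : G →₀ H) : ℂ :=
  f.sum fun m h => g.sum fun n k => inner ℂ h (κ m n k)

lemma kernelForm_add_left (κ : G → G → H →L[ℂ] H) (f f' g : G →₀ H) :
    kernelForm κ (f + f') g = kernelForm κ f g + kernelForm κ f' g := by
  unfold kernelForm
  classical rw [Finsupp.sum_add_index'] <;> simp [Finsupp.sum_add]

lemma kernelForm_smul_left (κ : G → G → H →L[ℂ] H) (f g : G →₀ H) (r : ℂ) :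
    kernelForm κ (r • f) g = starRingEnd ℂ r * kernelForm κ f g := by
  unfold kernelForm
  rw [Finsupp.sum_smul_index' (by simp)]
  simp only [Finsupp.sum, inner_smul_left, Finset.mul_sum]

@[simp] lemma kernelForm_single (κ : G → G → H →L[ℂ] H) (m n : G) (h k : H) :
    kernelForm κ (Finsupp.single m h) (Finsupp.single n k) = inner ℂ h (κ m n k) := by
  simp [kernelForm]

lemma kernelForm_conj [CompleteSpace H] {κ : G → G → H →L[ℂ] H} (hκ : ∀ m n, star (κ m n) = κ n m)
    (f g : G →₀ H) : starRingEnd ℂ (kernelForm κ g f) = kernelForm κ f g := by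
  unfold kernelForm
  simp only [Finsupp.sum, map_sum]
  rw [Finset.sum_comm]
  refine Finset.sum_congr rfl fun m _ => Finset.sum_congr rfl fun n _ => ?_
  rw [inner_conj_symm, ← hκ, ContinuousLinearMap.star_eq_adjoint,
    ContinuousLinearMap.adjoint_inner_left]

/-- The semi-inner product attached to a positive semidefinite kernel. -/
@[reducible] noncomputable def kernelCore [CompleteSpace H] (κ : G → G → H →L[ℂ] H)
    (hκ : ∀ m n, star (κ m n) = κ n m)
    (hpos : ∀ f, 0 ≤ (kernelForm κ f f).re) : PreInnerProductSpace.Core ℂ (G →₀ H) where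
  inner := kernelForm κ
  conj_inner_symm f g := kernelForm_conj hκ f g
  re_inner_nonneg := hpos
  add_left := kernelForm_add_left κ
  smul_left f g r := kernelForm_smul_left κ f g r

variable [AddCommGroup G]

/-- The twisted translation `e_m ⊗ h ↦ exp (i B s m) e_{s+m} ⊗ h`. -/
noncomputable def twistedShift (B : G →ₗ[ℤ] G →ₗ[ℤ] ℝ) (s : G) : (G →₀ H) →ₗ[ℂ] (G →₀ H) :=
  Finsupp.lsum ℂ fun m => phase (B s m) • Finsupp.lsingle (s + m)

@[simp] lemma twistedShift_single (B : G →ₗ[ℤ] G →ₗ[ℤ] ℝ) (s m : G) (h : H) :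
    twistedShift B s (Finsupp.single m h) = Finsupp.single (s + m) (phase (B s m) • h) := by
  simp [twistedShift]

/-- **Kolmogorov decomposition** of a positive semidefinite kernel that is invariant under a group
up to the cocycle `exp (i B)`, with the projective unitary representation that implements the
translations. -/
theorem exists_projective_dilation [CompleteSpace H] (B : G →ₗ[ℤ] G →ₗ[ℤ] ℝ) (κ : G → G → H →L[ℂ] H)
    (hκ : ∀ m n, star (κ m n) = κ n m) (hpos : ∀ f, 0 ≤ (kernelForm κ f f).re)
    (hshift : ∀ s m n, κ (s + m) (s + n) = phase (B s m - B s n) • κ m n)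
    (hone : κ 0 0 = 1) :
    ∃ (K : Type (max u v)) (_ : NormedAddCommGroup K) (_ : InnerProductSpace ℂ K)
      (_ : CompleteSpace K) (V : H →ₗᵢ[ℂ] K) (W : G → unitary (K →L[ℂ] K)),
      (∀ s t, (W s : K →L[ℂ] K) * W t = phase (B s t) • (W (s + t)).1) ∧
      ∀ m n h k, inner ℂ ((W m : K →L[ℂ] K) (V h)) ((W n : K →L[ℂ] K) (V k)) =
        inner ℂ h (κ m n k) := by
  let core := kernelCore κ hκ hpos
  let : SeminormedAddCommGroup (G →₀ H) :=
    InnerProductSpace.Core.toSeminormedAddCommGroup (𝕜 := ℂ)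
  let : InnerProductSpace ℂ (G →₀ H) := InnerProductSpace.ofCore core
  have inner_single : ∀ m n (h k : H),
      inner ℂ (Finsupp.single m h : G →₀ H) (Finsupp.single n k) = inner ℂ h (κ m n k) :=
    fun m n h k => kernelForm_single κ m n h k
  have inner_shift : ∀ s (f g : G →₀ H),
      inner ℂ (twistedShift B s f) (twistedShift B s g) = inner ℂ f g := by
    intro s f g
    induction f using Finsupp.induction_linear with
    | zero => simp
    | add f f' hf hf' => simp only [map_add, inner_add_left, hf, hf']
    | single m h =>
      induction g using Finsupp.induction_linear with
      | zero => simp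
      | add f f' hf hf' => simp only [map_add, inner_add_right, hf, hf']
      | single n k =>
        simp only [twistedShift_single, inner_single, hshift, map_smul, inner_smul_left,
          inner_smul_right, _root_.smul_apply, conj_phase, ← mul_assoc, ← phase_add]
        rw [show B s n + (B s m - B s n + -B s m) = 0 by ring, phase_zero, one_mul]
  let w : G → (G →₀ H) →ₗᵢ[ℂ] (G →₀ H) := fun s =>
    ⟨twistedShift B s, fun x => by
      rw [@norm_eq_sqrt_re_inner ℂ, @norm_eq_sqrt_re_inner ℂ, inner_shift]⟩
  have w_apply : ∀ s x, w s x = twistedShift B s x := fun _ _ => rfl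
  obtain ⟨W, W_coe, W_mul⟩ := exists_unitary_completion B w
    (fun x => by
      rw [w_apply]
      induction x using Finsupp.induction_linear with
      | zero => simp
      | add f f' hf hf' => simp only [map_add, hf, hf']
      | single m h => simp)
    (fun s t x => by
      simp only [w_apply]
      induction x using Finsupp.induction_linear with
      | zero => simp
      | add f f' hf hf' => simp only [map_add, hf, hf', smul_add]
      | single m h =>
        simp only [twistedShift_single, Finsupp.smul_single, smul_smul, ← phase_add, map_add,
          LinearMap.add_apply, add_assoc])
  let V₀ : H →ₗᵢ[ℂ] (G →₀ H) := ⟨Finsupp.lsingle 0, fun h => by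
    rw [@norm_eq_sqrt_re_inner ℂ, @norm_eq_sqrt_re_inner ℂ]
    simp only [Finsupp.lsingle_apply]
    rw [inner_single, hone]
    rfl⟩
  refine ⟨Completion (G →₀ H), inferInstance, inferInstance, inferInstance,
    Completion.toComplₗᵢ.comp V₀, W, W_mul, fun m n h k => ?_⟩
  have V_apply : ∀ h, (Completion.toComplₗᵢ.comp V₀) h =
      ((Finsupp.single 0 h : G →₀ H) : Completion (G →₀ H)) := fun _ => rfl
  rw [V_apply, V_apply, W_coe, W_coe, Completion.inner_coe, w_apply, w_apply,
    twistedShift_single, twistedShift_single, inner_single]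
  simp

end GNS


/-! ### Normal ordering of monomials and its cocycle -/

section OrderedProducts

variable {Λ : Type*}

/-- The integer bilinear form on `Λ →₀ ℤ` with matrix `θ`. -/
noncomputable def form (θ : Λ → Λ → ℝ) : (Λ →₀ ℤ) →ₗ[ℤ] (Λ →₀ ℤ) →ₗ[ℤ] ℝ :=
  Finsupp.linearCombination ℤ fun i => Finsupp.linearCombination ℤ (θ i)

@[simp] lemma form_single_single (θ : Λ → Λ → ℝ) (i j : Λ) (m n : ℤ) :
    form θ (Finsupp.single i m) (Finsupp.single j n) = m * n * θ i j := by
  simp [form, mul_assoc]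

variable {θ : Λ → Λ → ℝ}

variable {R : Type*} [Ring R]

section Phases

variable [Algebra ℂ R]

lemma pow_mul_pow_of_phase {A B : R} {t : ℝ} (h : A * B = phase t • (B * A)) (m n : ℕ) :
    A ^ m * B ^ n = phase (m * n * t) • (B ^ n * A ^ m) := by
  have h1 : ∀ n : ℕ, A * B ^ n = phase (n * t) • (B ^ n * A) := by
    intro n
    induction n with
    | zero => simp
    | succ n ih =>
      rw [pow_succ, ← mul_assoc, ih, smul_mul_assoc, mul_assoc, h, mul_smul_comm, smul_smul,
        ← phase_add, mul_assoc]
      push_cast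
      ring_nf
  induction m with
  | zero => simp
  | succ m ih =>
    rw [pow_succ, mul_assoc, h1, mul_smul_comm, ← mul_assoc, ih, smul_mul_assoc, smul_smul,
      ← phase_add, mul_assoc (B ^ n), ← pow_succ]
    push_cast
    ring_nf

/-- The exponent of the phase that arises when a product is brought into normal form. -/
noncomputable def listExponent (θ : Λ → Λ → ℝ) : List (Λ →₀ ℤ) → ℝ
  | [] => 0
  | a :: l => form θ a l.sum + listExponent θ l

/-- The phase depends on the exponents and `θ` alone, not on `M`. Applied to `orderedProd T` and to
the dilating representation, it gives equal phases, which need not be evaluated. -/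
lemma list_prod_eq_phase {M : (Λ →₀ ℤ) → R} (hM0 : M 0 = 1)
    (hM : ∀ a b, 0 ≤ a → 0 ≤ b → M a * M b = phase (form θ a b) • M (a + b))
    (l : List (Λ →₀ ℤ)) (hl : ∀ a ∈ l, 0 ≤ a) :
    (l.map M).prod = phase (listExponent θ l) • M l.sum := by
  induction l with
  | nil => simp [listExponent, hM0]
  | cons a l ih =>
    have hl' : ∀ b ∈ l, 0 ≤ b := fun b hb => hl b (List.mem_cons_of_mem a hb)
    rw [List.map_cons, List.prod_cons, ih hl', mul_smul_comm,
      hM a _ (hl a List.mem_cons_self) (List.sum_nonneg hl'), smul_smul, ← phase_add,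
      List.sum_cons, listExponent, add_comm]

end Phases

variable [LinearOrder Λ]

/-- The product of the powers `T i ^ (a i)⁺`, in increasing order of `i`. -/
noncomputable def orderedProd (T : Λ → R) (a : Λ →₀ ℤ) : R :=
  ((a.support.sort (· ≤ ·)).map fun i => T i ^ (a i).toNat).prod

@[simp] lemma orderedProd_zero (T : Λ → R) : orderedProd T 0 = 1 := by simp [orderedProd]

lemma orderedProd_single_add (T : Λ → R) {x : Λ} {a : Λ →₀ ℤ} (ha : ∀ i ∈ a.support, x < i)
    (n : ℤ) : orderedProd T (Finsupp.single x n + a) = T x ^ n.toNat * orderedProd T a := by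
  by_cases hn : n = 0
  · simp [hn]
  have hx : x ∉ a.support := fun h => lt_irrefl _ (ha x h)
  rw [orderedProd, Finsupp.support_single_add hx hn,
    Finset.sort_cons _ (fun b hb => (ha b hb).le), List.map_cons, List.prod_cons, orderedProd]
  congr 2
  · simp [Finsupp.notMem_support_iff.1 hx]
  · refine List.map_congr_left fun i hi => ?_
    have : i ≠ x := (ha i ((Finset.mem_sort _).1 hi)).ne'
    simp [Finsupp.single_eq_of_ne this]

@[simp] lemma orderedProd_single (T : Λ → R) (x : Λ) (n : ℤ) :
    orderedProd T (Finsupp.single x n) = T x ^ n.toNat := by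
  simpa using orderedProd_single_add T (x := x) (a := 0) (by simp) n

/-- Multiplying on the left by a power of the smallest variable keeps a monomial ordered, so it
costs no phase. -/
lemma form_single_eq_zero (hθ : ∀ i j, i ≤ j → θ i j = 0) {x : Λ} {b : Λ →₀ ℤ}
    (hb : ∀ i ∈ b.support, x ≤ i) (n : ℤ) : form θ (Finsupp.single x n) b = 0 := by
  rw [form, Finsupp.linearCombination_single, LinearMap.smul_apply,
    Finsupp.linearCombination_apply, Finsupp.sum, Finset.sum_eq_zero, smul_zero]
  intro i hi
  rw [hθ x i (hb i hi), smul_zero]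

lemma le_and_le_of_single_add {x : Λ} {n : ℤ} {a : Λ →₀ ℤ} (ha : x ∉ a.support)
    (h : 0 ≤ Finsupp.single x n + a) : 0 ≤ n ∧ 0 ≤ a := by
  have hx : 0 ≤ n := by simpa [Finsupp.notMem_support_iff.1 ha] using h x
  refine ⟨hx, fun i => ?_⟩
  by_cases hi : i = x
  · simp [hi, Finsupp.notMem_support_iff.1 ha]
  · simpa [Finsupp.single_eq_of_ne hi] using h i

variable [Algebra ℂ R]

lemma orderedProd_mul_pow {T : Λ → R}
    (hT : ∀ i j, j < i → T i * T j = phase (θ i j) • (T j * T i))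
    {x : Λ} (n : ℤ) (hn : 0 ≤ n) (a : Λ →₀ ℤ) :
    0 ≤ a → (∀ i ∈ a.support, x < i) → orderedProd T a * T x ^ n.toNat =
      phase (form θ a (Finsupp.single x n)) • (T x ^ n.toNat * orderedProd T a) := by
  induction a using Finsupp.induction_on_min with
  | zero => simp
  | single_add y b a hya hb ih =>
    intro ha hx
    have hy : y ∉ a.support := fun h => lt_irrefl _ (hya y h)
    obtain ⟨hb0, ha0⟩ := le_and_le_of_single_add hy ha
    rw [Finsupp.support_single_add hy hb] at hx
    have hxy : x < y := hx y (Finset.mem_cons_self _ _)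
    have hpow := pow_mul_pow_of_phase (hT y x hxy) b.toNat n.toNat
    have hb' : ((b.toNat : ℕ) : ℝ) = b := by exact_mod_cast Int.toNat_of_nonneg hb0
    have hn' : ((n.toNat : ℕ) : ℝ) = n := by exact_mod_cast Int.toNat_of_nonneg hn
    rw [hb', hn'] at hpow
    rw [orderedProd_single_add T hya, mul_assoc,
      ih ha0 fun i hi => hx i (Finset.mem_cons_of_mem hi), mul_smul_comm, ← mul_assoc, hpow,
      smul_mul_assoc, smul_smul, ← phase_add, mul_assoc, map_add, LinearMap.add_apply,
      form_single_single, add_comm, mul_assoc, mul_assoc (b : ℝ)]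

/-- Split off the smallest variable `x` from both factors. The only new phase comes from moving the
right-hand power of `x` past the rest of the left factor; the tails are handled by induction. -/
lemma orderedProd_mul (hθ : ∀ i j, i ≤ j → θ i j = 0) {T : Λ → R}
    (hT : ∀ i j, j < i → T i * T j = phase (θ i j) • (T j * T i)) (a b : Λ →₀ ℤ)
    (ha : 0 ≤ a) (hb : 0 ≤ b) :
    orderedProd T a * orderedProd T b = phase (form θ a b) • orderedProd T (a + b) := by
  suffices h : ∀ s : Finset Λ, ∀ a b : Λ →₀ ℤ, a.support ⊆ s → b.support ⊆ s → 0 ≤ a → 0 ≤ b →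
      orderedProd T a * orderedProd T b = phase (form θ a b) • orderedProd T (a + b) from
    h (a.support ∪ b.support) a b Finset.subset_union_left Finset.subset_union_right ha hb
  clear ha hb a b
  intro s
  induction s using Finset.induction_on_min with
  | empty =>
    intro a b ha hb _ _
    rw [Finset.subset_empty, Finsupp.support_eq_empty] at ha hb
    simp [ha, hb]
  | insert x s hxs ih =>
    intro a b has hbs ha hb
    have key : ∀ c : Λ →₀ ℤ, c.support ⊆ insert x s → 0 ≤ c → ∃ (n : ℤ) (d : Λ →₀ ℤ),
        c = Finsupp.single x n + d ∧ d.support ⊆ s ∧ 0 ≤ n ∧ 0 ≤ d := by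
      intro c hc hc0
      have hsub : (c.erase x).support ⊆ s := by
        rw [Finsupp.support_erase]
        exact (Finset.erase_subset_erase x hc).trans (Finset.erase_insert_subset x s)
      have hadd := (Finsupp.single_add_erase x c).symm
      exact ⟨c x, c.erase x, hadd, hsub, le_and_le_of_single_add (by simp) (hadd ▸ hc0)⟩
    obtain ⟨m, a, rfl, has, hm, ha⟩ := key a has ha
    obtain ⟨n, b, rfl, hbs, hn, hb⟩ := key b hbs hb
    have hxa : ∀ i ∈ a.support, x < i := fun i hi => hxs i (has hi)
    have hxb : ∀ i ∈ b.support, x < i := fun i hi => hxs i (hbs hi)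
    have hxab : ∀ i ∈ (a + b).support, x < i := fun i hi =>
      hxs i (Finset.union_subset has hbs (Finsupp.support_add hi))
    rw [show Finsupp.single x m + a + (Finsupp.single x n + b) =
        Finsupp.single x (m + n) + (a + b) by rw [Finsupp.single_add]; abel,
      orderedProd_single_add T hxa, orderedProd_single_add T hxb, orderedProd_single_add T hxab,
      mul_assoc, ← mul_assoc (orderedProd T a), orderedProd_mul_pow hT n hn a ha hxa,
      smul_mul_assoc, mul_assoc, ih a b has hbs ha hb, mul_smul_comm, mul_smul_comm, mul_smul_comm,
      smul_smul, ← phase_add, ← mul_assoc, ← pow_add, Int.toNat_add hm hn]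
    congr 2
    simp only [map_add, LinearMap.add_apply, form_single_single, hθ x x le_rfl,
      form_single_eq_zero hθ fun i hi => (hxb i hi).le]
    ring

end OrderedProducts


/-! ### Brehmer's telescoping and positivity of the regular kernel -/

section Brehmer

lemma support_subset_of_le {Λ : Type*} {l k : Λ →₀ ℤ} (hl : 0 ≤ l) (hlk : l ≤ k) :
    l.support ⊆ k.support := by
  intro i hi
  rw [Finsupp.mem_support_iff] at hi ⊢
  have h1 : 0 ≤ l i := hl i
  have h2 := hlk i
  omega

variable {Λ : Type*} [LinearOrder Λ] {H : Type*} [NormedAddCommGroup H]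
  [InnerProductSpace ℂ H] [CompleteSpace H]

/-- The Brehmer operators `∑_{F ⊆ S} (-1)^|F| (T_F)* T_F`, defined recursively by
`Δ_{S ∪ {x}} = Δ_S - (T x)* Δ_S (T x)` for `x < S`. -/
noncomputable def defect (T : Λ → H →L[ℂ] H) (S : Finset Λ) : H →L[ℂ] H :=
  (S.sort (· ≤ ·)).foldr (fun x D => D - star (T x) * D * T x) 1

@[simp] lemma defect_empty (T : Λ → H →L[ℂ] H) : defect T ∅ = 1 := by simp [defect]

lemma defect_insert (T : Λ → H →L[ℂ] H) {x : Λ} {S : Finset Λ} (hx : ∀ i ∈ S, x < i) :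
    defect T (insert x S) = defect T S - star (T x) * defect T S * T x := by
  have : x ∉ S := fun h => lt_irrefl _ (hx x h)
  rw [defect, Finset.sort_insert _ (fun b hb => (hx b hb).le) this, List.foldr_cons, defect]

/-- The one-variable telescope: the terms with `j > 0` are differences of consecutive conjugates of
`D`, and the term `j = 0` supplies the remaining endpoint. -/
lemma sum_range_conjugate {R : Type*} [Ring R] [StarRing R] (A D : R) (n : ℕ) :
    ∑ j ∈ Finset.range (n + 1), star (A ^ (n - j)) *
      (if j = 0 then D else D - star A * D * A) * A ^ (n - j) = D := by
  induction n with
  | zero => simp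
  | succ n ih =>
    rw [Finset.sum_range_succ]
    have : ∀ j ∈ Finset.range (n + 1), star (A ^ (n + 1 - j)) *
        (if j = 0 then D else D - star A * D * A) * A ^ (n + 1 - j) =
        star A * (star (A ^ (n - j)) * (if j = 0 then D else D - star A * D * A) *
          A ^ (n - j)) * A := by
      intro j hj
      rw [Nat.succ_sub (Nat.lt_succ_iff.1 (Finset.mem_range.1 hj)), pow_succ, star_mul]
      simp only [mul_assoc]
    rw [Finset.sum_congr rfl this, ← Finset.sum_mul, ← Finset.mul_sum, ih]
    simp

/-- Telescoping: the identity as a sum of conjugates of Brehmer operators. -/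
lemma sum_defect (T : Λ → H →L[ℂ] H) (k : Λ →₀ ℤ) :
    0 ≤ k → ∑ l ∈ Finset.Icc 0 k, star (orderedProd T (k - l)) * defect T l.support *
      orderedProd T (k - l) = 1 := by
  induction k using Finsupp.induction_on_min with
  | zero => simp
  | single_add x n k hx hn ih =>
    intro hk
    have hxk : x ∉ k.support := fun h => lt_irrefl _ (hx x h)
    obtain ⟨hn0, hk0⟩ := le_and_le_of_single_add hxk hk
    lift n to ℕ using hn0
    have hval : ∀ l ∈ Finset.Icc 0 k, l.support ⊆ k.support := fun l hl =>
      support_subset_of_le (Finset.mem_Icc.1 hl).1 (Finset.mem_Icc.1 hl).2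
    have hzero : ∀ l ∈ Finset.Icc 0 k, l x = 0 := fun l hl =>
      Finsupp.notMem_support_iff.1 fun h => hxk (hval l hl h)
    -- Split `l` into its `x`-coordinate `j` and the rest. As `x` is smallest, its powers stand next
    -- to the defect, so the sum over `j` is the one-variable telescope and no commutation relation
    -- is needed.
    have hreindex : ∑ l ∈ Finset.Icc 0 (Finsupp.single x (n : ℤ) + k),
        star (orderedProd T (Finsupp.single x (n : ℤ) + k - l)) * defect T l.support *
          orderedProd T (Finsupp.single x (n : ℤ) + k - l) =
        ∑ p ∈ Finset.Icc 0 k ×ˢ Finset.range (n + 1),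
          star (orderedProd T (k - p.1)) * (star (T x ^ (n - p.2)) *
            (if p.2 = 0 then defect T p.1.support else
              defect T p.1.support - star (T x) * defect T p.1.support * T x) *
            T x ^ (n - p.2)) * orderedProd T (k - p.1) := by
      symm
      refine Finset.sum_bij' (fun p _ => Finsupp.single x (p.2 : ℤ) + p.1)
        (fun l _ => (l.erase x, (l x).toNat)) ?_ ?_ ?_ ?_ ?_
      · rintro ⟨l, j⟩ hp
        rw [Finset.mem_product, Finset.mem_range, Nat.lt_succ_iff] at hp
        obtain ⟨hl, hj⟩ := hp
        rw [Finset.mem_Icc] at hl ⊢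
        refine ⟨add_nonneg ?_ hl.1, add_le_add ?_ hl.2⟩
        · exact Finsupp.single_nonneg.2 (by positivity)
        · exact Finsupp.single_mono (by exact_mod_cast hj)
      · intro l hl
        rw [Finset.mem_Icc] at hl
        have hkx : k x = 0 := Finsupp.notMem_support_iff.1 hxk
        have h1 := hl.2 x
        have h0 : 0 ≤ l x := hl.1 x
        simp only [Finsupp.add_apply, Finsupp.single_eq_same, hkx, add_zero] at h1
        rw [Finset.mem_product, Finset.mem_range, Finset.mem_Icc]
        refine ⟨⟨fun i => ?_, fun i => ?_⟩, by dsimp only; omega⟩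
        · by_cases hi : i = x
          · simp [hi]
          · simpa [Finsupp.erase_ne hi] using hl.1 i
        · by_cases hi : i = x
          · simp [hi, hkx]
          · simpa [Finsupp.erase_ne hi, Finsupp.single_eq_of_ne hi] using hl.2 i
      · rintro ⟨l, j⟩ hp
        have hlx := hzero l (Finset.mem_product.1 hp).1
        ext i
        · by_cases hi : i = x
          · simp [hi, hlx]
          · simp [Finsupp.erase_ne hi]
        · simp [hlx]
      · intro l hl
        have h0 : 0 ≤ l x := (Finset.mem_Icc.1 hl).1 x
        dsimp only
        rw [Int.toNat_of_nonneg h0, Finsupp.single_add_erase]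
      · rintro ⟨l, j⟩ hp
        rw [Finset.mem_product, Finset.mem_range, Nat.lt_succ_iff] at hp
        obtain ⟨hl, hj⟩ := hp
        dsimp only at hl hj ⊢
        have hxl : ∀ i ∈ l.support, x < i := fun i hi => hx i (hval l hl hi)
        have hxkl : ∀ i ∈ (k - l).support, x < i := fun i hi => hx i
          (Finset.union_subset subset_rfl (hval l hl) (Finsupp.support_sub hi))
        have hdef : defect T (Finsupp.single x (j : ℤ) + l).support =
            if j = 0 then defect T l.support else
              defect T l.support - star (T x) * defect T l.support * T x := by
          split_ifs with hj0
          · simp [hj0]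
          · rw [Finsupp.support_single_add (Finsupp.notMem_support_iff.2 (hzero l hl))
              (by exact_mod_cast hj0), Finset.cons_eq_insert, defect_insert T hxl]
        rw [show Finsupp.single x (n : ℤ) + k - (Finsupp.single x (j : ℤ) + l) =
            Finsupp.single x ((n : ℤ) - j) + (k - l) by rw [Finsupp.single_sub]; abel,
          orderedProd_single_add T hxkl, hdef, star_mul,
          show ((n : ℤ) - j).toNat = n - j by omega]
        simp only [mul_assoc]
    rw [hreindex, Finset.sum_product, ← ih hk0]
    refine Finset.sum_congr rfl fun l _ => ?_
    dsimp only
    rw [← Finset.sum_mul, ← Finset.mul_sum, sum_range_conjugate]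

/-- The kernel `⟨U^m h, U^n k⟩` that a regular dilation `U` of `T` must have. -/
noncomputable def regularKernel (θ : Λ → Λ → ℝ) (T : Λ → H →L[ℂ] H) (m n : Λ →₀ ℤ) :
    H →L[ℂ] H :=
  phase (form θ (m ⊓ n) (m - n)) •
    (star (orderedProd T (m - m ⊓ n)) * orderedProd T (n - m ⊓ n))

variable {θ : Λ → Λ → ℝ} {T : Λ → H →L[ℂ] H}

lemma star_regularKernel (m n : Λ →₀ ℤ) :
    star (regularKernel θ T m n) = regularKernel θ T n m := by
  rw [regularKernel, regularKernel, star_smul, star_phase, star_mul, star_star, inf_comm n m,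
    ← map_neg, neg_sub]

lemma regularKernel_add (s m n : Λ →₀ ℤ) : regularKernel θ T (s + m) (s + n) =
    phase (form θ s m - form θ s n) • regularKernel θ T m n := by
  rw [regularKernel, regularKernel, ← add_inf, add_sub_add_left_eq_sub, add_sub_add_left_eq_sub,
    add_sub_add_left_eq_sub, smul_smul, ← phase_add, map_add, LinearMap.add_apply, map_sub]

lemma regularKernel_of_inf_eq_zero {m n : Λ →₀ ℤ} (h : m ⊓ n = 0) :
    regularKernel θ T m n = star (orderedProd T m) * orderedProd T n := by
  simp [regularKernel, h]

/-- Insert the telescoped identity between the two monomials. The phases combine to that of `form θ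
l m - form θ l n`, so every summand splits into a factor in `(l, m)` and one in `(l, n)`; positivity
rests on this. -/
lemma regularKernel_eq_sum (hθ : ∀ i j, i ≤ j → θ i j = 0)
    (hT : ∀ i j, j < i → T i * T j = phase (θ i j) • (T j * T i)) {b m n : Λ →₀ ℤ}
    (hm : b ≤ m) (hn : b ≤ n) :
    regularKernel θ T m n = ∑ l ∈ Finset.Icc b (m ⊓ n),
      star (phase (-form θ l m) • orderedProd T (m - l)) * defect T (l - b).support *
        (phase (-form θ l n) • orderedProd T (n - l)) := by
  have hb : b ≤ m ⊓ n := le_inf hm hn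
  set k := m ⊓ n with hk
  have hsum := sum_defect T (k - b) (sub_nonneg.2 hb)
  have hreindex : ∑ l ∈ Finset.Icc 0 (k - b), star (orderedProd T (k - b - l)) *
      defect T l.support * orderedProd T (k - b - l) =
      ∑ l ∈ Finset.Icc b k, star (orderedProd T (k - l)) *
        defect T (l - b).support * orderedProd T (k - l) := by
    refine Finset.sum_bij' (fun l _ => l + b) (fun l _ => l - b) ?_ ?_ ?_ ?_ ?_
    · intro l hl
      rw [Finset.mem_Icc] at hl ⊢
      exact ⟨le_add_of_nonneg_left hl.1, le_sub_iff_add_le.1 hl.2⟩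
    · intro l hl
      rw [Finset.mem_Icc] at hl ⊢
      exact ⟨sub_nonneg.2 hl.1, sub_le_sub_right hl.2 b⟩
    · intros; simp
    · intros; simp
    · intro l _
      rw [add_sub_cancel_right, sub_sub, add_comm b l]
  rw [hreindex] at hsum
  have hexp : regularKernel θ T m n = phase (form θ k (m - n)) •
      (star (orderedProd T (m - k)) * (∑ l ∈ Finset.Icc b k, star (orderedProd T (k - l)) *
        defect T (l - b).support * orderedProd T (k - l)) * orderedProd T (n - k)) := by
    rw [hsum, mul_one, regularKernel]
  rw [hexp, Finset.mul_sum, Finset.sum_mul, Finset.smul_sum]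
  refine Finset.sum_congr rfl fun l hl => ?_
  rw [Finset.mem_Icc] at hl
  have hmul : ∀ c, k ≤ c → orderedProd T (k - l) * orderedProd T (c - k) =
      phase (form θ (k - l) (c - k)) • orderedProd T (c - l) := fun c hc => by
    rw [orderedProd_mul hθ hT _ _ (sub_nonneg.2 hl.2) (sub_nonneg.2 hc), add_comm,
      sub_add_sub_cancel]
  have hregroup : star (orderedProd T (m - k)) * (star (orderedProd T (k - l)) *
      defect T (l - b).support * orderedProd T (k - l)) * orderedProd T (n - k) =
      star (orderedProd T (k - l) * orderedProd T (m - k)) * defect T (l - b).support *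
        (orderedProd T (k - l) * orderedProd T (n - k)) := by
    rw [star_mul]
    simp only [mul_assoc]
  rw [hregroup, hmul m inf_le_left, hmul n inf_le_right]
  simp only [star_smul, star_phase, smul_mul_assoc, mul_smul_comm, smul_smul, ← phase_add]
  congr 2
  simp only [map_sub, LinearMap.sub_apply]
  ring

/-- **Brehmer's condition** implies that the regular kernel is positive semidefinite. -/
lemma kernelForm_regularKernel_nonneg (hθ : ∀ i j, i ≤ j → θ i j = 0)
    (hT : ∀ i j, j < i → T i * T j = phase (θ i j) • (T j * T i))
    (hpos : ∀ S, 0 ≤ defect T S) (f : (Λ →₀ ℤ) →₀ H) :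
    0 ≤ (kernelForm (regularKernel θ T) f f).re := by
  classical
  -- Exponents may be negative, so the telescoping starts from a common lower bound `b` of the
  -- finite support rather than from `0`.
  obtain ⟨b, hb⟩ : ∃ b, ∀ m ∈ f.support, b ≤ m :=
    Finset.exists_le (α := (Λ →₀ ℤ)ᵒᵈ) f.support
  obtain ⟨t, ht⟩ : ∃ t, ∀ m ∈ f.support, m ≤ t := Finset.exists_le f.support
  -- The value `0` off `l ≤ m` lets all pairs `(m, n)` share the index set `Finset.Icc b t`.
  let A : (Λ →₀ ℤ) → (Λ →₀ ℤ) → H →L[ℂ] H := fun l m =>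
    if l ≤ m then phase (-form θ l m) • orderedProd T (m - l) else 0
  have hκ : ∀ m ∈ f.support, ∀ n ∈ f.support, regularKernel θ T m n =
      ∑ l ∈ Finset.Icc b t, star (A l m) * defect T (l - b).support * A l n := by
    intro m hm n hn
    rw [regularKernel_eq_sum hθ hT (hb m hm) (hb n hn)]
    have hsub : Finset.Icc b (m ⊓ n) ⊆ Finset.Icc b t :=
      Finset.Icc_subset_Icc_right (inf_le_left.trans (ht m hm))
    rw [← Finset.sum_subset hsub]
    · refine Finset.sum_congr rfl fun l hl => ?_
      have := le_inf_iff.1 (Finset.mem_Icc.1 hl).2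
      simp only [A, if_pos this.1, if_pos this.2]
    · intro l hl hl'
      rw [Finset.mem_Icc] at hl hl'
      have : ¬ (l ≤ m ∧ l ≤ n) := fun h => hl' ⟨hl.1, le_inf h.1 h.2⟩
      by_cases h : l ≤ m
      · have h' : ¬ l ≤ n := fun h' => this ⟨h, h'⟩
        simp [A, h']
      · simp [A, h]
  have hform : kernelForm (regularKernel θ T) f f = ∑ l ∈ Finset.Icc b t,
      inner ℂ (∑ m ∈ f.support, A l m (f m))
        (defect T (l - b).support (∑ n ∈ f.support, A l n (f n))) := by
    have hterm : ∀ m ∈ f.support, ∀ n ∈ f.support,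
        inner ℂ (f m) (regularKernel θ T m n (f n)) = ∑ l ∈ Finset.Icc b t,
          inner ℂ (A l m (f m)) (defect T (l - b).support (A l n (f n))) := by
      intro m hm n hn
      rw [hκ m hm n hn, _root_.sum_apply, inner_sum]
      refine Finset.sum_congr rfl fun l _ => ?_
      rw [mul_assoc, mul_apply_eq_comp, ContinuousLinearMap.star_eq_adjoint,
        ContinuousLinearMap.adjoint_inner_right, mul_apply_eq_comp]
    rw [kernelForm, Finsupp.sum]
    simp only [Finsupp.sum]
    rw [Finset.sum_congr rfl fun m hm => Finset.sum_congr rfl (hterm m hm)]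
    simp only [map_sum, sum_inner, inner_sum]
    rw [Finset.sum_congr rfl fun m _ => Finset.sum_comm, Finset.sum_comm]
    exact Finset.sum_congr rfl fun l _ => Finset.sum_comm
  rw [hform, Complex.re_sum]
  exact Finset.sum_nonneg fun l _ =>
    ((ContinuousLinearMap.nonneg_iff_isPositive _).1 (hpos _)).re_inner_nonneg_right _

end Brehmer


lemma phase_arg {z : ℂ} (hz : ‖z‖ = 1) : phase z.arg = z := by
  have := Complex.norm_mul_exp_arg_mul_I z
  rwa [hz, Complex.ofReal_one, one_mul] at this

lemma phase_intCast_mul (n : ℤ) (x : ℝ) : phase (n * x) = phase x ^ n := by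
  simp [phase, ← Complex.exp_int_mul, mul_assoc]

/-! ### Products and exponent sums along a tuple of indices -/

section Lists

lemma star_list_prod {R : Type*} [Monoid R] [StarMul R] (l : List R) :
    star l.prod = (l.reverse.map star).prod := by
  induction l with
  | nil => simp
  | cons a l ih => simp [ih]

lemma mul_list_ofFn_prod {R : Type*} [Ring R] [Algebra ℂ R] {X : R} {k : ℕ} {f : Fin k → R}
    {c : Fin k → ℂ} (h : ∀ i, X * f i = c i • (f i * X)) :
    X * (List.ofFn f).prod = (∏ i, c i) • ((List.ofFn f).prod * X) := by
  induction k with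
  | zero => simp
  | succ k ih =>
    rw [List.ofFn_succ, List.prod_cons, ← mul_assoc, h, smul_mul_assoc, mul_assoc,
      ih fun i => h i.succ, mul_smul_comm, smul_smul, Fin.prod_univ_succ, mul_assoc]

variable {Λ : Type*} {k : ℕ} {α : Fin k → Λ}

lemma list_ofFn_single_sum_apply (hα : Function.Injective α) (x : Fin k → ℤ) (i : Fin k) :
    (List.ofFn fun j => Finsupp.single (α j) (x j)).sum (α i) = x i := by
  rw [List.sum_ofFn, Finsupp.finsetSum_apply, Finset.sum_eq_single i]
  · simp
  · intro j _ hj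
    exact Finsupp.single_eq_of_ne (hα.ne hj.symm)
  · simp

lemma list_ofFn_single_sum_apply_of_notMem {β : Λ} (hβ : ∀ i, α i ≠ β) (x : Fin k → ℤ) :
    (List.ofFn fun j => Finsupp.single (α j) (x j)).sum β = 0 := by
  rw [List.sum_ofFn, Finsupp.finsetSum_apply, Finset.sum_eq_zero]
  intro j _
  exact Finsupp.single_eq_of_ne (hβ j).symm

lemma negPart_inf_posPart_eq_zero (hα : Function.Injective α) (m : Fin k → ℤ) :
    (List.ofFn fun i => Finsupp.single (α i) (max (-m i) 0)).sum ⊓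
      (List.ofFn fun i => Finsupp.single (α i) (max (m i) 0)).sum = 0 := by
  ext β
  rw [Finsupp.inf_apply]
  by_cases hβ : ∃ i, α i = β
  · obtain ⟨i, rfl⟩ := hβ
    rw [list_ofFn_single_sum_apply hα, list_ofFn_single_sum_apply hα, Finsupp.zero_apply]
    omega
  · push Not at hβ
    rw [list_ofFn_single_sum_apply_of_notMem hβ, list_ofFn_single_sum_apply_of_notMem hβ]
    rfl

end Lists

/-! ### Regular products of unitaries -/

section Unitary

variable {K : Type*} [NormedAddCommGroup K] [InnerProductSpace ℂ K] [CompleteSpace K]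
  {Λ : Type*} {q : Λ → Λ → ℂ}

lemma coe_unitary_zpow (u : unitary (K →L[ℂ] K)) (m : ℤ) :
    ((u ^ m : unitary (K →L[ℂ] K)) : K →L[ℂ] K) =
      star ((u : K →L[ℂ] K) ^ (-m).toNat) * (u : K →L[ℂ] K) ^ m.toNat := by
  obtain ⟨n, rfl | rfl⟩ := m.eq_nat_or_neg
  · simp
  · simp [← Unitary.star_eq_inv]

/-- For a `q`-commuting family of unitaries the regular product is the plain product. -/
lemma regularProduct_unitary (hq : IsUnimodularFamily q) (U : Λ → unitary (K →L[ℂ] K))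
    (hU : IsQCommuting q fun α => (U α : K →L[ℂ] K)) {k : ℕ} (α : Fin k → Λ) (m : Fin k → ℤ)
    (hα : Function.Injective α) :
    regularProduct q (fun α => (U α : K →L[ℂ] K)) α m =
      ((List.ofFn fun i => U (α i) ^ m i).prod : unitary (K →L[ℂ] K)).1 := by
  induction k with
  | zero => simp [regularProduct]
  | succ k ih =>
    have ih := ih (fun i => α i.succ) (fun i => m i.succ)
      (hα.comp (Fin.succ_injective k))
    have hcomm : ∀ i : Fin k, (U (α 0) : K →L[ℂ] K) ^ (m 0).toNat *
        star ((U (α i.succ) : K →L[ℂ] K) ^ (-m i.succ).toNat) =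
        q (α 0) (α i.succ) ^ (-(max (m 0) 0 * max (-m i.succ) 0)) •
          (star ((U (α i.succ) : K →L[ℂ] K) ^ (-m i.succ).toNat) *
            (U (α 0) : K →L[ℂ] K) ^ (m 0).toNat) := by
      intro i
      have hne : α 0 ≠ α i.succ := hα.ne (Fin.succ_ne_zero i).symm
      have hnorm := (hq _ _ hne).1
      -- For unitaries the relation with adjoints is automatic: conjugate the `q`-commutation
      -- relation by the inverse of one factor.
      have hphase : (U (α 0) : K →L[ℂ] K) * star (U (α i.succ) : K →L[ℂ] K) =
          phase (-(q (α 0) (α i.succ)).arg) •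
            (star (U (α i.succ) : K →L[ℂ] K) * (U (α 0) : K →L[ℂ] K)) := by
        have h := hU _ _ hne
        dsimp only at h
        rw [phase_neg, phase_arg hnorm, eq_inv_smul_iff₀ (by
          rw [← norm_ne_zero_iff, hnorm]; exact one_ne_zero)]
        have h1 : (U (α i.succ) : K →L[ℂ] K) * star (U (α i.succ) : K →L[ℂ] K) = 1 :=
          Unitary.coe_mul_star_self _
        have h2 : star (U (α i.succ) : K →L[ℂ] K) * (U (α i.succ) : K →L[ℂ] K) = 1 :=
          Unitary.coe_star_mul_self _
        calc q (α 0) (α i.succ) • ((U (α 0) : K →L[ℂ] K) * star (U (α i.succ) : K →L[ℂ] K))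
            = star (U (α i.succ) : K →L[ℂ] K) * (q (α 0) (α i.succ) •
                ((U (α i.succ) : K →L[ℂ] K) * (U (α 0) : K →L[ℂ] K))) *
                  star (U (α i.succ) : K →L[ℂ] K) := by
              rw [mul_smul_comm, ← mul_assoc, h2, one_mul, smul_mul_assoc]
          _ = star (U (α i.succ) : K →L[ℂ] K) * (U (α 0) : K →L[ℂ] K) := by
              rw [← h, mul_assoc, mul_assoc, h1, mul_one]
      rw [star_pow, pow_mul_pow_of_phase hphase, mul_neg, phase_neg]
      congr 1
      rw [zpow_neg]
      nth_rw 2 [← phase_arg hnorm]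
      rw [← phase_intCast_mul, ← Int.toNat_eq_max, ← Int.toNat_eq_max]
      push_cast
      rfl
    have hmove := mul_list_ofFn_prod hcomm
    rw [List.ofFn_succ, List.prod_cons, Submonoid.coe_mul, ← ih, coe_unitary_zpow]
    simp only [regularProduct, List.ofFn_succ, List.prod_cons, Fin.prod_univ_succ,
      Fin.prod_Ioi_zero, Fin.prod_Ioi_succ]
    symm
    rw [mul_smul_comm, mul_assoc (star _), ← mul_assoc ((U (α 0) : K →L[ℂ] K) ^ (m 0).toNat),
      hmove, smul_mul_assoc, mul_smul_comm, smul_smul, mul_comm (∏ _, _)]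
    simp only [mul_assoc]

end Unitary

/-! ### From Brehmer's condition to the dilation -/

section Dilation

variable {Λ : Type v} {H : Type u} [NormedAddCommGroup H] [InnerProductSpace ℂ H]
  [CompleteSpace H] {q : Λ → Λ → ℂ} {T : Λ → H →L[ℂ] H}

lemma list_ofFn_star_prod {R : Type*} [Monoid R] [StarMul R] {k : ℕ} (f : Fin k → R) :
    (List.ofFn fun i => star (f i)).prod = star ((List.ofFn f).reverse.prod) := by
  rw [star_list_prod, List.reverse_reverse, List.map_ofFn]
  rfl

variable [LinearOrder Λ]

/-- A `q`-commuting family that satisfies Brehmer's condition has a regular `q`-unitary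
dilation. -/
theorem hasRegularQUnitaryDilation_of_defect_nonneg (hq : IsUnimodularFamily q)
    (hT : IsQCommuting q T) (hpos : ∀ S, 0 ≤ defect T S) : HasRegularQUnitaryDilation q T := by
  -- All of the argument of `q` is put below the diagonal to match increasing products; the zero
  -- diagonal makes `W` multiplicative along each coordinate axis.
  let θ : Λ → Λ → ℝ := fun i j => if j < i then (q i j).arg else 0
  have hθ : ∀ i j, i ≤ j → θ i j = 0 := fun i j h => if_neg h.not_gt
  have hθq : ∀ i j, i ≠ j → q i j = phase (θ i j - θ j i) := by
    intro i j hij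
    rcases lt_or_gt_of_ne hij with h | h
    · rw [hθ i j h.le, zero_sub, phase_neg, show θ j i = (q j i).arg from if_pos h,
        phase_arg (hq j i hij.symm).1, (hq i j hij).2]
    · rw [hθ j i h.le, sub_zero, show θ i j = (q i j).arg from if_pos h, phase_arg (hq i j hij).1]
  have hTθ : ∀ i j, j < i → T i * T j = phase (θ i j) • (T j * T i) := by
    intro i j h
    rw [hT i j h.ne', hθq i j h.ne', hθ j i h.le, sub_zero]
  obtain ⟨K, _, _, _, V, W, W_mul, W_inner⟩ := exists_projective_dilation (form θ)
    (regularKernel θ T) star_regularKernel (kernelForm_regularKernel_nonneg hθ hTθ hpos)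
    regularKernel_add (by simp [regularKernel])
  have W_zero : (W 0 : K →L[ℂ] K) = 1 := by
    have h := W_mul 0 0
    simp only [map_zero, phase_zero, one_smul, add_zero] at h
    exact congrArg Subtype.val (mul_eq_left.1 (Subtype.ext h))
  have W_single : ∀ i (n : ℕ), (W (Finsupp.single i (n : ℤ)) : K →L[ℂ] K) =
      (W (Finsupp.single i 1) : K →L[ℂ] K) ^ n := by
    intro i n
    induction n with
    | zero => simp [W_zero]
    | succ n ih =>
      rw [pow_succ, ← ih, W_mul, form_single_single, hθ i i le_rfl, mul_zero, phase_zero,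
        one_smul, ← Finsupp.single_add]
      push_cast
      rfl
  have hU : IsQCommuting q fun i => (W (Finsupp.single i 1) : K →L[ℂ] K) := by
    intro i j hij
    dsimp only
    rw [W_mul, W_mul, smul_smul, hθq i j hij, ← phase_add, add_comm (Finsupp.single j 1)]
    simp
  refine ⟨K, inferInstance, inferInstance, inferInstance, V, fun i => W (Finsupp.single i 1), hU,
    fun k α m hα => ?_⟩
  rw [← regularProduct_unitary hq _ hU α m hα]
  set lpos : List (Λ →₀ ℤ) := List.ofFn fun i => Finsupp.single (α i) (max (m i) 0) with hlpos
  set lneg : List (Λ →₀ ℤ) := List.ofFn fun i => Finsupp.single (α i) (max (-m i) 0) with hlneg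
  have lpos_nonneg : ∀ a ∈ lpos, 0 ≤ a := by
    simp only [hlpos, List.mem_ofFn, forall_exists_index, forall_apply_eq_imp_iff]
    exact fun i => Finsupp.single_nonneg.2 (le_max_right _ _)
  have lneg_nonneg : ∀ a ∈ lneg.reverse, 0 ≤ a := by
    simp only [hlneg, List.mem_reverse, List.mem_ofFn, forall_exists_index,
      forall_apply_eq_imp_iff]
    exact fun i => Finsupp.single_nonneg.2 (le_max_right _ _)
  have hW_list : ∀ x : Fin k → ℤ, (List.ofFn fun i =>
      (W (Finsupp.single (α i) 1) : K →L[ℂ] K) ^ (x i).toNat) =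
      (List.ofFn fun i => Finsupp.single (α i) (max (x i) 0)).map
        fun a => (W a : K →L[ℂ] K) := by
    intro x
    rw [List.map_ofFn]
    congr 1
    funext i
    rw [Function.comp_apply, ← Int.toNat_eq_max, W_single]
  have hT_list : ∀ x : Fin k → ℤ, (List.ofFn fun i => T (α i) ^ (x i).toNat) =
      (List.ofFn fun i => Finsupp.single (α i) (max (x i) 0)).map (orderedProd T) := by
    intro x
    rw [List.map_ofFn]
    congr 1
    funext i
    rw [Function.comp_apply, orderedProd_single, ← Int.toNat_eq_max, Int.toNat_natCast]
  have hW_phase := list_prod_eq_phase (θ := θ) (M := fun a => (W a : K →L[ℂ] K)) W_zero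
    fun a b _ _ => W_mul a b
  have hT_phase := list_prod_eq_phase (orderedProd_zero T) (orderedProd_mul hθ hTθ)
  have inner_eq : ∀ g h, inner ℂ ((W lneg.reverse.sum : K →L[ℂ] K) (V g))
      ((W lpos.sum : K →L[ℂ] K) (V h)) =
      inner ℂ (orderedProd T lneg.reverse.sum g) (orderedProd T lpos.sum h) := by
    intro g h
    have hinf : lneg.reverse.sum ⊓ lpos.sum = 0 := by
      rw [List.sum_reverse]
      exact negPart_inf_posPart_eq_zero hα m
    rw [W_inner, regularKernel_of_inf_eq_zero hinf, mul_apply_eq_comp,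
      ContinuousLinearMap.star_eq_adjoint, ContinuousLinearMap.adjoint_inner_right]
  ext h
  refine ext_inner_left ℂ fun g => ?_
  -- Both sides are now regular products with the same scalar factor. Putting them in normal form
  -- yields identical phases and leaves `inner_eq`.
  simp only [regularProduct, list_ofFn_star_prod, hW_list m, hW_list (fun i => -m i), hT_list m,
    hT_list (fun i => -m i), ← List.map_reverse]
  simp only [← hlpos, ← hlneg, hW_phase _ lpos_nonneg, hW_phase _ lneg_nonneg,
    hT_phase _ lpos_nonneg, hT_phase _ lneg_nonneg]
  simp only [ContinuousLinearMap.comp_apply, ContinuousLinearMap.adjoint_inner_right,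
    _root_.smul_apply, mul_apply_eq_comp, inner_smul_right,
    ContinuousLinearMap.star_eq_adjoint, LinearIsometry.coe_toContinuousLinearMap,
    inner_smul_left, inner_eq]

end Dilation

/-! ### Brehmer's condition in the three cases -/

section Brehmer

variable {Λ : Type*} [LinearOrder Λ] {H : Type*} [NormedAddCommGroup H]
  [InnerProductSpace ℂ H] [CompleteSpace H] {q : Λ → Λ → ℂ} {T : Λ → H →L[ℂ] H}

lemma defect_nonneg_of_isometry (hT : ∀ α, Isometry (T α)) (S : Finset Λ) : 0 ≤ defect T S := by
  -- The first variable gives `1 - (T x)* T x = 0`, and the recursion preserves zero.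
  have key : S = ∅ ∨ defect T S = 0 := by
    induction S using Finset.induction_on_min with
    | empty => exact Or.inl rfl
    | insert x S hx ih =>
      right
      have h1 : star (T x) * T x = 1 :=
        (ContinuousLinearMap.isometry_iff_adjoint_comp_self (T x)).1 (hT x)
      rcases ih with rfl | h0
      · rw [defect_insert T hx, defect_empty, mul_one, h1, sub_self]
      · simp [defect_insert T hx, h0]
  rcases key with rfl | h
  · rw [defect_empty]
    exact zero_le_one
  · exact h.ge

/-- Passing `T a` across `(T x)*` and across `T x` produces conjugate unimodular scalars, which
cancel. -/
lemma commute_defect (hq : IsUnimodularFamily q) (hT : IsDoublyQCommuting q T) {a : Λ}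
    (S : Finset Λ) (ha : a ∉ S) : Commute (T a) (defect T S) := by
  induction S using Finset.induction_on_min with
  | empty => simp
  | insert x S hx ih =>
    rw [Finset.mem_insert, not_or] at ha
    rw [defect_insert T hx]
    have hD := ih ha.2
    refine hD.sub_right ?_
    have hnorm : starRingEnd ℂ (q a x) * q a x = 1 := by
      rw [Complex.conj_mul', (hq a x ha.1).1]
      simp
    change T a * (star (T x) * defect T S * T x) = star (T x) * defect T S * T x * T a
    rw [← mul_assoc, ← mul_assoc, hT.2 a x ha.1, smul_mul_assoc, smul_mul_assoc,
      mul_assoc (star (T x)), hD.eq, mul_assoc, mul_assoc, hT.1 a x ha.1, mul_smul_comm,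
      mul_smul_comm, smul_smul, hnorm, one_smul]
    simp only [mul_assoc]

/-- By commutation the recursion factors as `Δ_S (1 - (T x)* T x)`, a product of commuting
nonnegative operators. -/
lemma defect_nonneg_of_doublyQCommuting (hq : IsUnimodularFamily q)
    (hT : IsDoublyQCommuting q T) (hcontr : ∀ α, ‖T α‖ ≤ 1) (S : Finset Λ) :
    0 ≤ defect T S := by
  induction S using Finset.induction_on_min with
  | empty => rw [defect_empty]; exact zero_le_one
  | insert x S hx ih =>
    have hcomm := commute_defect hq hT S fun h => lt_irrefl _ (hx x h)
    have hcomm' : Commute (star (T x)) (defect T S) := by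
      have := hcomm.star_star
      rwa [(IsSelfAdjoint.of_nonneg ih).star_eq] at this
    rw [defect_insert T hx, hcomm'.eq, mul_assoc, ← mul_one_sub]
    refine Commute.mul_nonneg ih ?_ ?_
    · rw [sub_nonneg]
      simpa using (CStarAlgebra.star_mul_le_algebraMap_norm_sq (a := T x)).trans
        (algebraMap_mono (H →L[ℂ] H) (pow_le_one₀ (norm_nonneg _) (hcontr x)))
    · exact ((Commute.one_right _).sub_right (hcomm'.symm.mul_right hcomm.symm))

lemma defect_nonneg_of_sum_le_one (hT : Summable fun α => ‖T α‖ ^ 2)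
    (hsum : ∑' α, ‖T α‖ ^ 2 ≤ 1) (S : Finset Λ) : 0 ≤ defect T S := by
  have hS : ∀ S : Finset Λ, ∑ α ∈ S, star (T α) * T α ≤ 1 := by
    intro S
    refine (Finset.sum_le_sum fun α _ =>
      CStarAlgebra.star_mul_le_algebraMap_norm_sq (a := T α)).trans ?_
    rw [← map_sum, ← map_one (algebraMap ℝ (H →L[ℂ] H))]
    exact algebraMap_mono (H →L[ℂ] H)
      ((hT.sum_le_tsum S fun α _ => sq_nonneg ‖T α‖).trans hsum)
  -- The bounds need each other: `Δ_S ≤ 1` limits what the recursion subtracts, and the lower bound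
  -- gives `Δ_S ≥ 0`, so that defects decrease.
  have key : 1 - ∑ α ∈ S, star (T α) * T α ≤ defect T S ∧ defect T S ≤ 1 := by
    induction S using Finset.induction_on_min with
    | empty => simp
    | insert x S hx ih =>
      have hxS : x ∉ S := fun h => lt_irrefl _ (hx x h)
      have hpos : 0 ≤ defect T S := (sub_nonneg.2 (hS S)).trans ih.1
      rw [defect_insert T hx, Finset.sum_insert hxS]
      constructor
      · have h := star_left_conjugate_le_conjugate ih.2 (T x)
        rw [mul_one] at h
        rw [add_comm, ← sub_sub]
        exact sub_le_sub ih.1 h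
      · exact (sub_le_self _ (star_left_conjugate_nonneg hpos _)).trans ih.2
  exact (sub_nonneg.2 (hS S)).trans key.1

end Brehmer

end QComm

theorem theorem1p7 {Λ : Type v} {H : Type u} [NormedAddCommGroup H] [InnerProductSpace ℂ H]
    [CompleteSpace H] (q : Λ → Λ → ℂ) (hq : QComm.IsUnimodularFamily q)
    (T : Λ → H →L[ℂ] H) (hT : QComm.IsQCommuting q T) (hcontr : ∀ α, ‖T α‖ ≤ 1) :
    ((∀ α, Isometry (T α)) → QComm.HasRegularQUnitaryDilation q T) ∧
    (QComm.IsDoublyQCommuting q T → QComm.HasRegularQUnitaryDilation q T) ∧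
    ((Countable Λ ∧ Summable (fun α => ‖T α‖ ^ 2) ∧ ∑' α, ‖T α‖ ^ 2 ≤ 1) →
      QComm.HasRegularQUnitaryDilation q T) := by
  classical
  let : LinearOrder Λ := linearOrderOfSTO WellOrderingRel
  exact ⟨fun h => QComm.hasRegularQUnitaryDilation_of_defect_nonneg hq hT
      (QComm.defect_nonneg_of_isometry h),
    fun h => QComm.hasRegularQUnitaryDilation_of_defect_nonneg hq hT
      (QComm.defect_nonneg_of_doublyQCommuting hq h hcontr),
    fun h => QComm.hasRegularQUnitaryDilation_of_defect_nonneg hq hT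
      (QComm.defect_nonneg_of_sum_le_one h.2.1 h.2.2)⟩
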